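/- Let $\mathbb X=(X_n,n\ge 1)$ be a strictly stationary sequence of real random variables on a probability space $(\Omega,\mathcal F,\mathbb P)$, let $X_{1:n}\le\dots\le X_{n:n}$ be the order statistics of $X_1,\dots,X_n$, and let $a>0$ be fixed. Let $\mathcal I^{\mathbb X}$ be the sigma-field of all sets $A$ for which there is a Borel set $B\subseteq\mathbb R^{\mathbb N}$ with $A=\{\omega:(X_i(\omega),X_{i+1}(\omega),\dots)\in B\}$ for every $i\ge1$. For a random variable $X$ and a sigma-field $\mathcal G\subseteq\mathcal F$, the conditional right endpoint $\gamma_1(X|\mathcal G)$ is the (a.s. unique) $\mathcal G$-measurable $[-\infty,\infty]$-valued $Q$ such that $\mathbb P(X\le Q|\mathcal G)=1$ a.s. and $Q\le Q_1$ a.s. for every $\mathcal G$-measurable $[-\infty,\infty]$-valued $Q_1$ with $\mathbb P(X\le Q_1|\mathcal G)=1$ a.s. For $1\le k\le n$ put $$K(k,n,a)=\sum_{i=1}^n I(X_{k:n}-a<X_i<X_{k:n}),\qquad S(k,n,a)=\sum_{i=1}^n X_i\, I(X_{k:n}-a<X_i<X_{k:n}).$$ Write $u\sim v$ if $u-v=o(v)$,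 that is, for every $\varepsilon>0$ eventually $|u-v|\le\varepsilon|v|$ (so $u=0$ wherever $v=0$, eventually). Theorem 4.3. Let $(k_n,n\ge1)$ be integers with $1\le k_n\le n$ for all $n\ge1$ and $k_n/n\to1$, and suppose that $\gamma_1(X_1|\mathcal I^{\mathbb X})=\infty$ a.s. Then, almost surely, $$\frac{S(k_n,n,a)}{X_{k_n:n}}\sim K(k_n,n,a)\qquad\text{as } n\to\infty.$$ If moreover $(N(t),t\ge0)$ is a process of non-negative integer-valued random variables on $(\Omega,\mathcal F,\mathbb P)$ with $N(t)\to\infty$ a.s. as $t\to\infty$, then, almost surely, $$\frac{S(k_{N(t)},N(t),a)}{X_{k_{N(t)}:N(t)}}\sim K(k_{N(t)},N(t),a)\qquad\text{as } t\to\infty.$$ (Almost surely, the denominators are positive for all large $n$, respectively $t$.) -/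

import Mathlib

open MeasureTheory ProbabilityTheory Filter Topology Asymptotics
open scoped NNReal

namespace NearOrderStat

noncomputable section

/-! A sequence of random variables `X₁, X₂, …` is represented by `X : ℕ → Ω → ℝ`, with `X i` standing
for `X_{i+1}`; the sample of size `n` is therefore `X 0, …, X (n - 1)`. -/

/-- Strict stationarity: for every `h`, the shifted sequence `(X_{1+h}, X_{2+h}, …)` has the same law
on `ℝ^ℕ` as `(X₁, X₂, …)`. -/
def IsStrictlyStationary {Ω : Type*} [MeasurableSpace Ω] (X : ℕ → Ω → ℝ) (μ : Measure Ω) : Prop :=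
  ∀ h : ℕ, IdentDistrib (fun ω (j : ℕ) => X (j + h) ω) (fun ω (j : ℕ) => X j ω) μ μ

/-- The sigma-field of events that are invariant with respect to the sequence `X`: the sets `A` for
which some Borel set `B ⊆ ℝ^ℕ` satisfies `A = {ω : (X_i(ω), X_{i+1}(ω), …) ∈ B}` for every `i`. -/
@[reducible] def invariantSigma {Ω : Type*} (X : ℕ → Ω → ℝ) : MeasurableSpace Ω where
  MeasurableSet' A :=
    ∃ B : Set (ℕ → ℝ), MeasurableSet B ∧ ∀ i : ℕ, A = {ω | (fun j : ℕ => X (i + j) ω) ∈ B}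
  measurableSet_empty := ⟨∅, MeasurableSet.empty, fun _ => by simp⟩
  measurableSet_compl := by
    rintro A ⟨B, hB, h⟩
    refine ⟨Bᶜ, hB.compl, fun i => ?_⟩
    rw [h i]
    rfl
  measurableSet_iUnion := by
    intro f hf
    choose B hB h using hf
    refine ⟨⋃ n, B n, MeasurableSet.iUnion hB, fun i => ?_⟩
    ext ω
    simp only [Set.mem_iUnion, Set.mem_ofPred_eq]
    refine exists_congr fun n => ?_
    rw [h n i]
    rfl

/-- `Q` is (a version of) the conditional right endpoint `γ₁(X|𝒢)` of the support of `X` given the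
sigma-field `𝒢`: the a.s. smallest `𝒢`-measurable extended random variable such that
`P(X ≤ Q | 𝒢) = 1` a.s. -/
structure IsCondRightEndpoint {Ω : Type*} [MeasurableSpace Ω] (μ : Measure Ω)
    (𝒢 : MeasurableSpace Ω) (X : Ω → ℝ) (Q : Ω → EReal) : Prop where
  measurable : Measurable[𝒢] Q
  condProb_eq_one : ∀ᵐ ω ∂μ, (μ⟦{ω' | (X ω' : EReal) ≤ Q ω'} | 𝒢⟧) ω = 1
  ae_le : ∀ Q₁ : Ω → EReal, Measurable[𝒢] Q₁ →
    (∀ᵐ ω ∂μ, (μ⟦{ω' | (X ω' : EReal) ≤ Q₁ ω'} | 𝒢⟧) ω = 1) → ∀ᵐ ω ∂μ, Q ω ≤ Q₁ ω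

/-- The order statistic `x_{k:n}`: the `k`-th entry (`1 ≤ k ≤ n`) of the nondecreasing rearrangement
of the first `n` terms of `x`. The value is `0` when `k` is out of range. -/
def orderStat (x : ℕ → ℝ) (k n : ℕ) : ℝ :=
  if h : 1 ≤ k ∧ k ≤ n then
    x (Tuple.sort (fun i : Fin n => x i) ⟨k - 1, by omega⟩ : Fin n)
  else 0

/-- `K(k, n, a)`: the number of the first `n` terms of `x` lying in `(x_{k:n} - a, x_{k:n})`. -/
def nearCount (x : ℕ → ℝ) (a : ℝ) (k n : ℕ) : ℝ :=
  ∑ i ∈ Finset.range n,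
    (Set.Ioo (orderStat x k n - a) (orderStat x k n)).indicator (fun _ => (1 : ℝ)) (x i)

/-- `S(k, n, a)`: the sum of those of the first `n` terms of `x` lying in
`(x_{k:n} - a, x_{k:n})`. -/
def nearSum (x : ℕ → ℝ) (a : ℝ) (k n : ℕ) : ℝ :=
  ∑ i ∈ Finset.range n,
    x i * (Set.Ioo (orderStat x k n - a) (orderStat x k n)).indicator (fun _ => (1 : ℝ)) (x i)

end

end NearOrderStat

/-! Everything follows pathwise from `X_{k_n:n} → ∞` a.s.: a term within `a` of a positive `X_{k:n}`
has ratio to it within `a / X_{k:n}` of `1`, so summing gives the equivalence, and a random index is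
a composition. Since `n - k_n = o(n)`, divergence holds once every level `M` is exceeded with
positive lower frequency (`tendsto_orderStat`). No ergodic theorem is needed. The paths visiting `U
= {x 0 > M}` with lower frequency zero form a shift-invariant set that meets `U` in a null set
(`measure_inter_rarelyVisiting`, a covering argument). On the corresponding invariant event, `X 0 ≤
M` a.s.; a conditional right endpoint equal to `⊤` forces that event to be null
(`ae_notMem_rarelyVisiting`). -/

namespace NearOrderStat

/-! ### Positive lower frequency of returns for measure-preserving maps. -/

section Recurrence

variable {α : Type*}

/-- The points whose orbit visits `U` with lower asymptotic frequency zero. -/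
def rarelyVisiting (T : α → α) (U : Set α) : Set α :=
  {x | ∀ j : ℕ, ∃ᶠ n : ℕ in atTop,
    birkhoffSum T (U.indicator fun _ => (1 : ℝ)) n x ≤ (n : ℝ) / (j + 1)}

lemma birkhoffSum_indicator_mono (T : α → α) {U W : Set α} (h : W ⊆ U) (n : ℕ) (x : α) :
    birkhoffSum T (W.indicator fun _ => (1 : ℝ)) n x ≤
      birkhoffSum T (U.indicator fun _ => (1 : ℝ)) n x :=
  Finset.sum_le_sum fun _ _ =>
    Set.indicator_le_indicator_of_subset h (fun _ => zero_le_one) _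

lemma birkhoffSum_indicator_le (T : α → α) (U : Set α) (n : ℕ) (x : α) :
    birkhoffSum T (U.indicator fun _ => (1 : ℝ)) n x ≤ n := by
  have : birkhoffSum T (U.indicator fun _ => (1 : ℝ)) n x ≤ ∑ _i ∈ Finset.range n, (1 : ℝ) :=
    Finset.sum_le_sum fun _ _ => Set.indicator_le_self' (fun _ _ => zero_le_one) _
  simpa using this

/-- If every point of `W` starts an orbit segment of length at most `N` along which `W` is visited
with frequency at most `ε`, then long orbit segments visit `W` with frequency about `ε`. -/
lemma birkhoffSum_indicator_le_of_short_segments (T : α → α) (W : Set α) {ε : ℝ} (hε : 0 ≤ ε)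
    (N : ℕ)
    (hW : ∀ x ∈ W, ∃ n, 1 ≤ n ∧ n ≤ N ∧
      birkhoffSum T (W.indicator fun _ => (1 : ℝ)) n x ≤ ε * n) (L : ℕ) (x : α) :
    birkhoffSum T (W.indicator fun _ => (1 : ℝ)) L x ≤ ε * L + N := by
  induction L using Nat.strong_induction_on generalizing x with
  | _ L ih =>
    -- Greedy tiling of the orbit: from a point of `W` jump over its whole sparse segment, otherwise
    -- advance one step. Only a last segment overrunning `L` is uncontrolled, and it costs at most
    -- `N`.
    by_cases hx : x ∈ W
    · obtain ⟨n, hn1, hnN, hn⟩ := hW x hx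
      rcases le_or_gt L n with hL | hL
      · have h1 := birkhoffSum_indicator_le T W L x
        have h2 : (L : ℝ) ≤ N := by exact_mod_cast hL.trans hnN
        have h3 : 0 ≤ ε * L := by positivity
        linarith
      · obtain ⟨m, rfl⟩ := Nat.exists_eq_add_of_lt hL
        have h1 := ih (m + 1) (by omega) (T^[n] x)
        rw [add_assoc, birkhoffSum_add]
        push_cast at h1 ⊢
        linarith
    · cases L with
      | zero => simp
      | succ m =>
        have h1 := ih m (by omega) (T x)
        rw [birkhoffSum_succ', Set.indicator_of_notMem hx]
        push_cast
        linarith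

lemma measurable_birkhoffSum_indicator [MeasurableSpace α] {T : α → α} (hT : Measurable T)
    {U : Set α} (hU : MeasurableSet U) (n : ℕ) :
    Measurable (birkhoffSum T (U.indicator fun _ => (1 : ℝ)) n) := by
  unfold birkhoffSum
  exact Finset.measurable_sum _ fun i _ =>
    (measurable_const.indicator hU).comp (hT.iterate i)

lemma measurableSet_rarelyVisiting [MeasurableSpace α] {T : α → α} (hT : Measurable T)
    {U : Set α} (hU : MeasurableSet U) : MeasurableSet (rarelyVisiting T U) := by
  have : rarelyVisiting T U = ⋂ j : ℕ, ⋂ m : ℕ, ⋃ n : ℕ, ⋃ _ : m ≤ n,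
      {x | birkhoffSum T (U.indicator fun _ => (1 : ℝ)) n x ≤ (n : ℝ) / (j + 1)} := by
    ext x
    simp [rarelyVisiting, frequently_atTop]
  rw [this]
  exact .iInter fun j => .iInter fun m => .iUnion fun n => .iUnion fun _ =>
    measurableSet_le (measurable_birkhoffSum_indicator hT hU n) measurable_const

/-- Under a measure-preserving map, the orbit of almost every point of `U` visits `U` with positive
lower frequency. -/
theorem measure_inter_rarelyVisiting [MeasurableSpace α] {ν : Measure α} [IsProbabilityMeasure ν]
    {T : α → α} (hT : MeasurePreserving T ν ν) {U : Set α} (hU : MeasurableSet U) :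
    ν (U ∩ rarelyVisiting T U) = 0 := by
  suffices h : ∀ j : ℕ, ν.real (U ∩ rarelyVisiting T U) ≤ 1 / ((j : ℝ) + 1) by
    rw [← measureReal_eq_zero_iff]
    exact le_antisymm (ge_of_tendsto' tendsto_one_div_add_atTop_nhds_zero_nat h)
      measureReal_nonneg
  intro j
  set ε : ℝ := 1 / ((j : ℝ) + 1) with hε_def
  have hε : 0 ≤ ε := by positivity
  -- Truncating at `N` bounds the segment lengths, as the tiling lemma requires; `1 ≤ n` excludes
  -- the empty segment, for which the inequality is trivial.
  let G : ℕ → Set α := fun N => ⋃ n : ℕ, ⋃ _ : 1 ≤ n ∧ n ≤ N,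
    {x | birkhoffSum T (U.indicator fun _ => (1 : ℝ)) n x ≤ ε * n}
  have hG : ∀ N, MeasurableSet (G N) := fun N => .iUnion fun n => .iUnion fun _ =>
    measurableSet_le (measurable_birkhoffSum_indicator hT.measurable hU n) measurable_const
  have hmono : Monotone fun N => U ∩ G N := by
    intro N N' h x hx
    simp only [G, Set.mem_inter_iff, Set.mem_iUnion, Set.mem_ofPred_eq] at hx ⊢
    obtain ⟨hxU, n, hn, hx⟩ := hx
    exact ⟨hxU, n, ⟨hn.1, hn.2.trans h⟩, hx⟩
  have hsub : U ∩ rarelyVisiting T U ⊆ ⋃ N, U ∩ G N := by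
    rintro x ⟨hxU, hx⟩
    obtain ⟨n, hn1, hn⟩ := frequently_atTop.1 (hx j) 1
    simp only [G, Set.mem_inter_iff, Set.mem_iUnion, Set.mem_ofPred_eq]
    refine ⟨n, hxU, n, ⟨hn1, le_rfl⟩, hn.trans (le_of_eq ?_)⟩
    rw [hε_def]; ring
  have hbound : ∀ N, ν.real (U ∩ G N) ≤ ε := by
    intro N
    have hWm : MeasurableSet (U ∩ G N) := hU.inter (hG N)
    have hpt := birkhoffSum_indicator_le_of_short_segments T (U ∩ G N) hε N (by
      intro x hx
      simp only [G, Set.mem_inter_iff, Set.mem_iUnion, Set.mem_ofPred_eq] at hx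
      obtain ⟨-, n, hn, hx⟩ := hx
      exact ⟨n, hn.1, hn.2, (birkhoffSum_indicator_mono T Set.inter_subset_left n x).trans hx⟩)
    have hint : ∀ i : ℕ,
        Integrable (fun x => (U ∩ G N).indicator (fun _ => (1 : ℝ)) (T^[i] x)) ν := fun i =>
      (hT.iterate i).integrable_comp_of_integrable ((integrable_const 1).indicator hWm)
    have hint_eq : ∀ i : ℕ,
        ∫ x, (U ∩ G N).indicator (fun _ => (1 : ℝ)) (T^[i] x) ∂ν = ν.real (U ∩ G N) := by
      intro i
      rw [← integral_map (f := (U ∩ G N).indicator (fun _ => (1 : ℝ)))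
        (hT.iterate i).measurable.aemeasurable
        (measurable_const.indicator hWm).aestronglyMeasurable, (hT.iterate i).map_eq,
        integral_indicator hWm]
      simp
    -- Integrate the pointwise bound using invariance of `ν`; the additive `N` becomes negligible as
    -- `L` grows.
    have hL : ∀ L : ℕ, (L : ℝ) * ν.real (U ∩ G N) ≤ ε * L + N := by
      intro L
      have h1 : ∫ x, birkhoffSum T ((U ∩ G N).indicator fun _ => (1 : ℝ)) L x ∂ν ≤
          ∫ _x, (ε * L + N) ∂ν := by
        refine integral_mono ?_ (integrable_const _) fun x => hpt L x
        exact integrable_finsetSum _ fun i _ => hint i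
      have h2 : ∫ x, birkhoffSum T ((U ∩ G N).indicator fun _ => (1 : ℝ)) L x ∂ν =
          L * ν.real (U ∩ G N) := by
        unfold birkhoffSum
        rw [integral_finsetSum _ fun i _ => hint i]
        simp [hint_eq]
      rw [h2] at h1
      simpa using h1
    by_contra! hlt
    obtain ⟨L, hL'⟩ := exists_nat_gt ((N : ℝ) / (ν.real (U ∩ G N) - ε))
    rw [div_lt_iff₀ (sub_pos.2 hlt)] at hL'
    linarith [hL L]
  have hlim : Tendsto (fun N => ν.real (U ∩ G N)) atTop (𝓝 (ν.real (⋃ N, U ∩ G N))) :=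
    (ENNReal.tendsto_toReal (measure_ne_top _ _)).comp (tendsto_measure_iUnion_atTop hmono)
  exact (measureReal_mono hsub).trans (le_of_tendsto' hlim hbound)

/-- Dropping or adding the first orbit point changes the count by at most one. Starting from the
threshold for `2 * j + 1`, half that for `j`, leaves room for this and for the change of length. -/
lemma map_mem_rarelyVisiting_iff (T : α → α) (U : Set α) (x : α) :
    T x ∈ rarelyVisiting T U ↔ x ∈ rarelyVisiting T U := by
  have hsucc : ∀ n, birkhoffSum T (U.indicator fun _ => (1 : ℝ)) (n + 1) x =
      U.indicator (fun _ => (1 : ℝ)) x + birkhoffSum T (U.indicator fun _ => (1 : ℝ)) n (T x) :=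
    fun n => birkhoffSum_succ' T _ n x
  have h0 : 0 ≤ U.indicator (fun _ => (1 : ℝ)) x := Set.indicator_nonneg (fun _ _ => zero_le_one) x
  have h1 : U.indicator (fun _ => (1 : ℝ)) x ≤ 1 :=
    Set.indicator_le_self' (fun _ _ => zero_le_one) x
  constructor <;> intro hx j <;> rw [frequently_atTop] <;> intro m
  · obtain ⟨n, hn, h⟩ := frequently_atTop.1 (hx (2 * j + 1)) (m + (2 * j + 2))
    refine ⟨n + 1, by omega, ?_⟩
    have hj : (0 : ℝ) < j + 1 := by positivity
    have hn' : (2 * j + 2 : ℝ) ≤ n := by exact_mod_cast (show 2 * j + 2 ≤ n by omega)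
    rw [hsucc]
    push_cast at h ⊢
    have e : (n : ℝ) / (2 * j + 1 + 1) = n / (j + 1) / 2 := by field_simp; ring
    have e2 : (2 : ℝ) ≤ n / (j + 1) := by rw [le_div_iff₀ hj]; linarith
    have e3 : (n : ℝ) / (j + 1) ≤ (n + 1) / (j + 1) := by gcongr; linarith
    linarith
  · obtain ⟨n, hn, h⟩ := frequently_atTop.1 (hx (2 * j + 1)) (m + 2)
    obtain ⟨p, rfl⟩ : ∃ p, n = p + 1 := ⟨n - 1, by omega⟩
    refine ⟨p, by omega, ?_⟩
    have hj : (0 : ℝ) < j + 1 := by positivity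
    have hp : (1 : ℝ) ≤ p := by exact_mod_cast (show 1 ≤ p by omega)
    rw [hsucc] at h
    push_cast at h
    have e : ((p : ℝ) + 1) / (2 * j + 1 + 1) ≤ p / (j + 1) := by
      rw [div_le_div_iff₀ (by positivity) hj]; nlinarith
    linarith

end Recurrence

/-- The one-sided shift on real sequences. -/
def shift (x : ℕ → ℝ) : ℕ → ℝ := fun j => x (j + 1)

lemma measurable_shift : Measurable shift :=
  measurable_pi_lambda _ fun j => measurable_pi_apply (j + 1)

lemma iterate_shift (i : ℕ) (x : ℕ → ℝ) : shift^[i] x = fun j => x (i + j) := by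
  induction i generalizing x with
  | zero => simp
  | succ i ih =>
    rw [Function.iterate_succ_apply, ih]
    funext j
    simp only [shift]
    congr 1
    omega

lemma iterate_shift_mem_rarelyVisiting_iff (U : Set (ℕ → ℝ)) (i : ℕ) (x : ℕ → ℝ) :
    (fun j => x (i + j)) ∈ rarelyVisiting shift U ↔ x ∈ rarelyVisiting shift U := by
  rw [← iterate_shift]
  induction i with
  | zero => rfl
  | succ i ih => rw [Function.iterate_succ_apply', map_mem_rarelyVisiting_iff, ih]

/-! ### From the conditional right endpoint to frequent exceedances. -/

section Stationary

variable {Ω : Type*} [MeasurableSpace Ω] {μ : Measure Ω} {X : ℕ → Ω → ℝ}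

lemma invariantSigma_le (hX : ∀ i, Measurable (X i)) :
    invariantSigma X ≤ (inferInstance : MeasurableSpace Ω) := by
  rintro A ⟨B, hB, h⟩
  rw [h 0]
  exact measurableSet_preimage (measurable_pi_lambda _ fun j => hX (0 + j)) hB

lemma IsStrictlyStationary.measurePreserving_shift (hX : ∀ i, Measurable (X i))
    (h : IsStrictlyStationary X μ) :
    MeasurePreserving shift (μ.map fun ω j => X j ω) (μ.map fun ω j => X j ω) := by
  refine ⟨measurable_shift, ?_⟩
  rw [Measure.map_map measurable_shift (measurable_pi_lambda _ hX)]
  exact (h 1).map_eq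

/-- If `X 0` has conditional right endpoint `⊤` given the invariant sigma-field, then almost surely
the sequence exceeds any given level with positive lower frequency. -/
lemma ae_notMem_rarelyVisiting [IsProbabilityMeasure μ] (hX : ∀ i, Measurable (X i))
    (hstat : IsStrictlyStationary X μ) {γ : Ω → EReal}
    (hγ : IsCondRightEndpoint μ (invariantSigma X) (X 0) γ) (hγ_top : ∀ᵐ ω ∂μ, γ ω = ⊤) (M : ℝ) :
    ∀ᵐ ω ∂μ, (fun j => X j ω) ∉ rarelyVisiting shift {x : ℕ → ℝ | M < x 0} := by
  classical
  set U : Set (ℕ → ℝ) := {x | M < x 0} with hU_def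
  have hU : MeasurableSet U := measurableSet_lt measurable_const (measurable_pi_apply 0)
  have hpath : Measurable fun ω j => X j ω := measurable_pi_lambda _ hX
  have hR : MeasurableSet (rarelyVisiting shift U) :=
    measurableSet_rarelyVisiting measurable_shift hU
  set A : Set Ω := {ω | (fun j => X j ω) ∈ rarelyVisiting shift U} with hA_def
  have hA : MeasurableSet[invariantSigma X] A :=
    ⟨rarelyVisiting shift U, hR, fun i => by
      ext ω
      exact (iterate_shift_mem_rarelyVisiting_iff U i fun j => X j ω).symm⟩
  have := Measure.isProbabilityMeasure_map (μ := μ) hpath.aemeasurable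
  have hnull := measure_inter_rarelyVisiting (hstat.measurePreserving_shift hX) hU
  rw [Measure.map_apply hpath (hU.inter hR)] at hnull
  have hle : ∀ᵐ ω ∂μ, ω ∈ A → X 0 ω ≤ M := by
    filter_upwards [measure_eq_zero_iff_ae_notMem.1 hnull] with ω hω hωA
    by_contra! hlt
    exact hω ⟨hlt, hωA⟩
  -- A competitor for the endpoint: an invariant upper bound of `X 0` that is finite on `A`.
  -- Minimality of `γ = ⊤` then makes `A` null.
  let Q : Ω → EReal := A.piecewise (fun _ => (M : EReal)) fun _ => ⊤
  have hQ : Measurable[invariantSigma X] Q :=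
    Measurable.piecewise (m := invariantSigma X) (mβ := inferInstance) hA measurable_const
      measurable_const
  have hXQ : ({ω | (X 0 ω : EReal) ≤ Q ω}.indicator fun _ => (1 : ℝ)) =ᵐ[μ] fun _ => (1 : ℝ) := by
    filter_upwards [hle] with ω hω
    refine Set.indicator_of_mem ?_ _
    by_cases hωA : ω ∈ A
    · simpa [Q, hωA] using hω hωA
    · simp [Q, hωA]
  have hcond : ∀ᵐ ω ∂μ, (μ⟦{ω' | (X 0 ω' : EReal) ≤ Q ω'} | invariantSigma X⟧) ω = 1 := by
    have h := condExp_congr_ae (m := invariantSigma X) hXQ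
    rw [condExp_const (invariantSigma_le hX)] at h
    exact h
  filter_upwards [hγ.ae_le Q hQ hcond, hγ_top] with ω hω htop hωA
  have hωA' : ω ∈ A := hωA
  rw [htop] at hω
  simp [Q, hωA'] at hω

end Stationary

/-! ### Order statistics and near-order sums of a fixed sequence. -/

section Deterministic

variable {x : ℕ → ℝ} {a : ℝ} {k n : ℕ}

/-- The order statistic `x_{k:n}` exceeds `M` once more than `n - k` of the terms do. -/
lemma lt_orderStat (hk : 1 ≤ k ∧ k ≤ n) {M : ℝ}
    (h : n < k + ((Finset.range n).filter fun i => M < x i).card) : M < orderStat x k n := by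
  by_contra! hle
  rw [orderStat, dif_pos hk] at hle
  set σ := Tuple.sort fun i : Fin n => x i with hσ
  have hmono : Monotone ((fun i : Fin n => x i) ∘ σ) := Tuple.monotone_sort _
  have hsmall : ∀ i : Fin k, x (σ (Fin.castLE hk.2 i)) ≤ M := fun i =>
    (hmono (show Fin.castLE hk.2 i ≤ ⟨k - 1, by omega⟩ by
      rw [Fin.le_def]; simp only [Fin.val_castLE]; omega)).trans hle
  -- The first `k` sorted positions give `k` distinct indices with value at most `M`, too many given
  -- the number of exceedances.
  have hcard : k ≤ ((Finset.range n).filter fun i => ¬ M < x i).card := by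
    have := Finset.card_le_card_of_injOn (s := (Finset.univ : Finset (Fin k)))
      (t := (Finset.range n).filter fun i => ¬ M < x i)
      (fun i => (σ (Fin.castLE hk.2 i) : ℕ)) (fun i _ => by simpa using hsmall i)
      (fun i _ j _ hij => Fin.castLE_injective hk.2 (σ.injective (Fin.ext hij)))
    simpa using this
  have := Finset.card_filter_add_card_filter_not (s := Finset.range n) fun i => M < x i
  rw [Finset.card_range] at this
  omega

lemma birkhoffSum_shift_indicator (x : ℕ → ℝ) (M : ℝ) (n : ℕ) :
    birkhoffSum shift ({x : ℕ → ℝ | M < x 0}.indicator fun _ => (1 : ℝ)) n x =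
      ((Finset.range n).filter fun i => M < x i).card := by
  classical
  simp [birkhoffSum, iterate_shift, Set.indicator_apply, Finset.sum_boole]

/-- If a sequence exceeds every level with positive lower frequency and `k n / n → 1`, then its
order statistics `x_{k n : n}` tend to infinity. -/
lemma tendsto_orderStat {k : ℕ → ℕ} (hk : ∀ n, 1 ≤ n → 1 ≤ k n ∧ k n ≤ n)
    (hk_lim : Tendsto (fun n : ℕ => (k n : ℝ) / (n : ℝ)) atTop (𝓝 1))
    (hx : ∀ M : ℕ, x ∉ rarelyVisiting shift {x : ℕ → ℝ | (M : ℝ) < x 0}) :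
    Tendsto (fun n => orderStat x (k n) n) atTop atTop := by
  refine tendsto_atTop.2 fun b => ?_
  obtain ⟨M, hM⟩ := exists_nat_ge b
  have hxM := hx M
  simp only [rarelyVisiting, Set.mem_ofPred_eq, not_forall, not_frequently, not_le,
    birkhoffSum_shift_indicator] at hxM
  obtain ⟨j, hj⟩ := hxM
  have hδ : (0 : ℝ) < 1 / ((j : ℝ) + 1) := by positivity
  -- With `δ = 1 / (j + 1)`, eventually `n - k n < δ * n`, while more than `δ * n` terms exceed `M`.
  filter_upwards [hj, hk_lim.eventually_const_lt (sub_lt_self 1 hδ), eventually_ge_atTop 1]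
    with n hn hkn hn1
  refine hM.trans (lt_orderStat (hk n hn1) ?_).le
  have hnpos : (0 : ℝ) < n := by exact_mod_cast hn1
  rw [lt_div_iff₀ hnpos] at hkn
  have e : (1 - 1 / ((j : ℝ) + 1)) * n = n - n / (j + 1) := by ring
  rw [e] at hkn
  have : (n : ℝ) < k n + ((Finset.range n).filter fun i => (M : ℝ) < x i).card := by linarith
  exact_mod_cast this

/-- The error is bounded term by term, so it vanishes when the window is empty; this is what `~`
demands where the count is zero. -/
lemma abs_nearSum_div_orderStat_sub_nearCount_le (hpos : 0 < orderStat x k n) :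
    |nearSum x a k n / orderStat x k n - nearCount x a k n| ≤
      a / orderStat x k n * |nearCount x a k n| := by
  have hK : 0 ≤ nearCount x a k n :=
    Finset.sum_nonneg fun i _ => Set.indicator_nonneg (fun _ _ => zero_le_one) _
  rw [abs_of_nonneg hK]
  unfold nearSum nearCount
  rw [Finset.sum_div, ← Finset.sum_sub_distrib, Finset.mul_sum]
  refine (Finset.abs_sum_le_sum_abs _ _).trans (Finset.sum_le_sum fun i _ => ?_)
  by_cases hi : x i ∈ Set.Ioo (orderStat x k n - a) (orderStat x k n)
  · rw [Set.indicator_of_mem hi, mul_one, mul_one]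
    have e : x i / orderStat x k n - 1 = (x i - orderStat x k n) / orderStat x k n := by
      field_simp
    rw [e, abs_div, abs_of_pos hpos]
    gcongr
    rw [abs_le]
    constructor <;> linarith [hi.1, hi.2]
  · simp [Set.indicator_of_notMem hi]

lemma isEquivalent_nearCount {k : ℕ → ℕ}
    (h : Tendsto (fun n => orderStat x (k n) n) atTop atTop) :
    (fun n : ℕ => nearSum x a (k n) n / orderStat x (k n) n) ~[atTop]
      fun n : ℕ => nearCount x a (k n) n := by
  refine IsLittleO.of_bound fun c hc => ?_
  have hlim : Tendsto (fun n => a / orderStat x (k n) n) atTop (𝓝 0) := h.const_div_atTop a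
  filter_upwards [h.eventually_gt_atTop 0, hlim.eventually_lt_const hc] with n hpos hlt
  simp only [Pi.sub_apply, Real.norm_eq_abs]
  exact (abs_nearSum_div_orderStat_sub_nearCount_le hpos).trans (by gcongr)

end Deterministic

end NearOrderStat

theorem theorem4p3 {Ω : Type*} [MeasurableSpace Ω] (μ : Measure Ω) [IsProbabilityMeasure μ]
    (X : ℕ → Ω → ℝ) (hX : ∀ i, Measurable (X i))
    (hstat : NearOrderStat.IsStrictlyStationary X μ)
    (γ : Ω → EReal)
    (hγ : NearOrderStat.IsCondRightEndpoint μ (NearOrderStat.invariantSigma X) (X 0) γ)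
    (hγ_top : ∀ᵐ ω ∂μ, γ ω = ⊤)
    (a : ℝ) (ha : 0 < a)
    (k : ℕ → ℕ) (hk : ∀ n, 1 ≤ n → 1 ≤ k n ∧ k n ≤ n)
    (hk_lim : Tendsto (fun n : ℕ => (k n : ℝ) / (n : ℝ)) atTop (𝓝 1)) :
    (∀ᵐ ω ∂μ,
      (fun n : ℕ => NearOrderStat.nearSum (fun i => X i ω) a (k n) n /
          NearOrderStat.orderStat (fun i => X i ω) (k n) n)
        ~[atTop] (fun n : ℕ => NearOrderStat.nearCount (fun i => X i ω) a (k n) n)) ∧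
    (∀ N : ℝ≥0 → Ω → ℕ, (∀ t, Measurable (N t)) →
      (∀ᵐ ω ∂μ, Tendsto (fun t : ℝ≥0 => N t ω) atTop atTop) →
      ∀ᵐ ω ∂μ,
        (fun t : ℝ≥0 => NearOrderStat.nearSum (fun i => X i ω) a (k (N t ω)) (N t ω) /
            NearOrderStat.orderStat (fun i => X i ω) (k (N t ω)) (N t ω))
          ~[atTop]
        (fun t : ℝ≥0 => NearOrderStat.nearCount (fun i => X i ω) a (k (N t ω)) (N t ω))) := by
  have htend : ∀ᵐ ω ∂μ,
      Tendsto (fun n => NearOrderStat.orderStat (fun i => X i ω) (k n) n) atTop atTop := by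
    filter_upwards [ae_all_iff.2 fun M : ℕ =>
      NearOrderStat.ae_notMem_rarelyVisiting hX hstat hγ hγ_top (M : ℝ)] with ω hω
    exact NearOrderStat.tendsto_orderStat hk hk_lim hω
  refine ⟨?_, fun N _ hN => ?_⟩
  · filter_upwards [htend] with ω hω
    exact NearOrderStat.isEquivalent_nearCount hω
  · filter_upwards [htend, hN] with ω hω hNω
    exact (NearOrderStat.isEquivalent_nearCount hω).comp_tendsto hNω
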